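/- For each sample size $n$ let $p=p_n$, $s=s_n$, $D=D_n$ be integers with $1\le s_n\le p_n$ and $D_n\ge 0$, and let $\Delta=\Delta_n\in\mathbb R$. Let $\mathbb P_n$ be the law on $\mathbb R^{pn}$ of $X=(X_1,\dots,X_n)$ with $$X_i=z_i\theta+\varepsilon_i,\qquad i=1,\dots,n,$$ where $z$, $\theta$ and $\varepsilon=(\varepsilon_1,\dots,\varepsilon_n)$ are independent, $\varepsilon_1,\dots,\varepsilon_n$ are i.i.d. $N(0,I_p)$, $z_1,\dots,z_n$ are i.i.d. Rademacher (uniform on $\{-1,1\}$), and $\theta\in\mathbb R^p$ is drawn as follows: a set $S$ is uniform among the subsets of $\{1,\dots,p\}$ with exactly $s$ elements and, given $S$, the coordinates $\theta_j$ are independent, with $\theta_j$ uniform on $\{-\Delta/\sqrt s,\Delta/\sqrt s\}$ for $j\in S$ and $\theta_j=0$ for $j\notin S$. Let $\mathbb Q_n$ be the law of $X$ when $\theta=0$, i.e. of $n$ i.i.d. samples from $N(0,I_p)$. Put $$\|L_n^{\le D}\|=\max_{f}\frac{\mathbb E_{X\sim\mathbb P_n}[f(X)]}{\sqrt{\mathbb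 E_{X\sim\mathbb Q_n}[f(X)^2]}},$$ the maximum being over polynomials $f:\mathbb R^{pn}\to\mathbb R$ of degree at most $D$ with $\mathbb E_{X\sim\mathbb Q_n}[f(X)^2]>0$. If $$\limsup_{n\to\infty}\left[\sqrt{\frac{n\Delta^4}{p}}+\sqrt{\frac{4n\Delta^4D}{s^2}}\right]<1,$$ then this maximum is attained for every $n$, and, as $n\to\infty$, $$\|L_n^{\le D}\|^2=1+O\left(\frac{n\Delta^4}{p}+\frac{n\Delta^4D}{s^2}\right).$$ -/

import Mathlib

open Filter Topology Asymptotics MeasureTheory ProbabilityTheory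

namespace SparseClustering

noncomputable section

/-- The Rademacher distribution: mass `1/2` at each of `1` and `-1`. -/
def rademacher : Measure ℝ :=
  (2⁻¹ : ENNReal) • Measure.dirac (1 : ℝ) + (2⁻¹ : ENNReal) • Measure.dirac (-1 : ℝ)

/-- The prior on the labels: `z₁, …, zₙ` i.i.d. Rademacher. -/
def labelPrior (n : ℕ) : Measure (Fin n → ℝ) :=
  Measure.pi fun _ => rademacher

/-- The law of the centre `θ ∈ ℝᵖ` given its support set `S`: the coordinates are independent,
`θᵢ` is `Δ/√s` times a Rademacher variable for `i ∈ S`, and `θᵢ = 0` for `i ∉ S`. -/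
def centrePriorGiven (p s : ℕ) (Δ : ℝ) (S : Finset (Fin p)) : Measure (Fin p → ℝ) :=
  (Measure.pi fun _ : Fin p => rademacher).map
    fun r i => if i ∈ S then Δ / √(s : ℝ) * r i else 0

/-- The prior on the centre: `S` is uniform among the `s`-element subsets of the coordinates,
and given `S` the centre is drawn from `centrePriorGiven p s Δ S`. -/
def centrePrior (p s : ℕ) (Δ : ℝ) : Measure (Fin p → ℝ) :=
  ∑ S ∈ (Finset.univ : Finset (Fin p)).powersetCard s,
    ((p.choose s : ENNReal)⁻¹) • centrePriorGiven p s Δ S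

/-- The null distribution: `n` i.i.d. samples from `N(0, I_p)`; coordinate `(i, j)` of the data
is the `j`-th coordinate of the `i`-th sample. -/
def nullLaw (n p : ℕ) : Measure (Fin n × Fin p → ℝ) :=
  Measure.pi fun _ => gaussianReal 0 1

/-- The planted distribution: the law of `Xᵢ = zᵢ θ + εᵢ`, `i = 1, …, n`, where the labels `z`,
the centre `θ` and the noise `ε` are independent, `z` and `θ` are drawn from their priors and
`ε₁, …, εₙ` are i.i.d. `N(0, I_p)`. -/
def plantedLaw (n p s : ℕ) (Δ : ℝ) : Measure (Fin n × Fin p → ℝ) :=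
  (((labelPrior n).prod (centrePrior p s Δ)).prod (nullLaw n p)).map
    fun ω ij => ω.1.1 ij.1 * ω.1.2 ij.2 + ω.2 ij

/-- The values `E_P[f] / √(E_Q[f²])`, where `f` ranges over the real polynomials of degree at
most `D` for which the quotient makes sense. -/
def lowDegreeRatios {ι : Type*} (P Q : Measure (ι → ℝ)) (D : ℕ) : Set ℝ :=
  {r | ∃ f : MvPolynomial ι ℝ, f.totalDegree ≤ D ∧ 0 < ∫ x, (MvPolynomial.eval x f) ^ 2 ∂Q ∧
    r = (∫ x, MvPolynomial.eval x f ∂P) / √(∫ x, (MvPolynomial.eval x f) ^ 2 ∂Q)}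

/-- The norm `‖L^{≤ D}‖` of the degree-`D` likelihood ratio of `P` against `Q`, that is, the
supremum of `E_P[f] / √(E_Q[f²])` over polynomials `f` of degree at most `D`. -/
def lowDegreeNorm {ι : Type*} (P Q : Measure (ι → ℝ)) (D : ℕ) : ℝ :=
  sSup (lowDegreeRatios P Q D)

end

end SparseClustering

/-! Under the Gaussian null the normalised Hermite polynomials are orthonormal, and those of degree
at most `D` span the polynomials of degree at most `D`. By Cauchy–Schwarz the norm is therefore the
Euclidean length of the vector of normalised Hermite moments of the planted law, and it is attained
(`isGreatest_lowDegreeRatios`). The Hermite moment of a shifted Gaussian is a monomial in the shift,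
so the multinomial theorem turns the squared norm into `∑_{d ≤ D} E⟨u, u'⟩^d / d!`, where `u`, `u'`
are independent copies of the signal (`sum_sq_integral_mvHermite_gaussianMixture`).

Here `⟨u, u'⟩ = (Δ²/s) A B`, where `A` is a sum of `n` independent signs and `B`, given the two
supports, a sum of `|S ∩ S'|` independent signs. Odd `d` contribute nothing. For `d = 2k`,
`signMoment_le` bounds the moments of `A` and `B` by Gaussian ones, with constant `(2k-1)!!` each,
and `sum_card_inter_pow_le` gives `E|S ∩ S'|^k ≤ (s²/p + k)^k`. Since `((2k-1)!!)² ≤ (2k)!`, the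
term is at most `(nΔ⁴/p + nΔ⁴k/s²)^k` (`degreeTerm_two_mul_le`). Replacing `k` by `D` leaves a
geometric series whose ratio is the claimed error; the limsup condition keeps this ratio eventually
below a constant smaller than 1. -/

namespace SparseClustering

/-! ### Hermite polynomials in one variable and Gaussian integration by parts. -/

section Hermite

/-- The `n`-th probabilists' Hermite polynomial with real coefficients. -/
noncomputable def hermiteReal (n : ℕ) : Polynomial ℝ :=
  (Polynomial.hermite n).map (Int.castRingHom ℝ)

theorem hermiteReal_zero : hermiteReal 0 = 1 := by
  simp [hermiteReal]

theorem hermiteReal_succ (n : ℕ) : hermiteReal (n + 1) =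
    Polynomial.X * hermiteReal n - Polynomial.derivative (hermiteReal n) := by
  simp [hermiteReal, Polynomial.hermite_succ, Polynomial.derivative_map]

theorem derivative_hermiteReal_succ (n : ℕ) :
    Polynomial.derivative (hermiteReal (n + 1)) = ((n : ℝ) + 1) • hermiteReal n := by
  induction n with
  | zero => simp [hermiteReal_succ, hermiteReal_zero]
  | succ n ih =>
    rw [hermiteReal_succ (n + 1), Polynomial.derivative_sub, Polynomial.derivative_mul, ih,
      Polynomial.derivative_smul]
    have h := hermiteReal_succ n
    rw [show Polynomial.derivative (hermiteReal n) =
      Polynomial.X * hermiteReal n - hermiteReal (n + 1) by rw [h]; ring]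
    simp only [Polynomial.smul_eq_C_mul, Polynomial.derivative_X]
    push_cast
    simp only [map_add, map_one]
    ring

theorem X_mul_hermiteReal_succ (n : ℕ) : Polynomial.X * hermiteReal (n + 1) =
    hermiteReal (n + 2) + ((n : ℝ) + 1) • hermiteReal n := by
  rw [hermiteReal_succ (n + 1), derivative_hermiteReal_succ]; ring

theorem natDegree_hermiteReal_le (n : ℕ) : (hermiteReal n).natDegree ≤ n := by
  refine (Polynomial.natDegree_map_le).trans ?_
  simp

/-- Polynomials are integrable against the standard Gaussian. -/
theorem integrable_eval_gaussian (q : Polynomial ℝ) :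
    Integrable (fun x => q.eval x) (gaussianReal 0 1) := by
  induction q using Polynomial.induction_on' with
  | add p q hp hq =>
    simp only [Polynomial.eval_add]
    exact hp.add hq
  | monomial n a =>
    simp only [Polynomial.eval_monomial]
    refine Integrable.const_mul ?_ a
    have h := memLp_id_gaussianReal (μ := 0) (v := 1) (n : NNReal)
    rcases Nat.eq_zero_or_pos n with rfl | hn
    · simp
    · have h2 := h.integrable_norm_pow hn.ne'
      refine h2.mono' (by fun_prop) ?_
      simp

/-- Gaussian integration by parts for polynomials. -/
theorem integral_mul_eval_gaussian (q : Polynomial ℝ) :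
    ∫ x, x * q.eval x ∂(gaussianReal 0 1) =
      ∫ x, (Polynomial.derivative q).eval x ∂(gaussianReal 0 1) := by
  have key : ∀ r : Polynomial ℝ, Integrable (fun x => gaussianPDFReal 0 1 x * r.eval x) := by
    intro r
    have h := integrable_eval_gaussian r
    rw [gaussianReal_of_var_ne_zero 0 one_ne_zero, integrable_withDensity_iff_integrable_smul'
      (measurable_gaussianPDF 0 1) (by simp [gaussianPDF_lt_top])] at h
    simpa [toReal_gaussianPDF] using h
  have hpdf : ∀ x, HasDerivAt (gaussianPDFReal 0 1) (-x * gaussianPDFReal 0 1 x) x := by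
    intro x
    have h : HasDerivAt (fun y : ℝ => (√(2 * Real.pi * (1 : NNReal)))⁻¹ *
        Real.exp (-(y - 0) ^ 2 / (2 * (1 : NNReal)))) _ x :=
      HasDerivAt.const_mul _ ((((hasDerivAt_id x).sub_const 0).pow 2).neg.div_const _).exp
    refine (h.congr_deriv ?_)
    simp [gaussianPDFReal]
    ring
  -- The derivative of density times `q` is density times `q' - x q`; being integrable with an
  -- integrable primitive, it has integral zero.
  have hz := integral_eq_zero_of_hasDerivAt_of_integrable
    (f := fun x => gaussianPDFReal 0 1 x * q.eval x)
    (f' := fun x => gaussianPDFReal 0 1 x * (Polynomial.derivative q - Polynomial.X * q).eval x)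
    (fun x => by
      refine ((hpdf x).mul (q.hasDerivAt x)).congr_deriv ?_
      simp
      ring) (key _) (key _)
  have h2 : ∫ x, (Polynomial.derivative q - Polynomial.X * q).eval x ∂(gaussianReal 0 1) = 0 := by
    rw [integral_gaussianReal_eq_integral_smul one_ne_zero]
    simpa using hz
  have h3 : ∫ x, ((Polynomial.derivative q).eval x - (Polynomial.X * q).eval x)
      ∂(gaussianReal 0 1) = 0 := by simpa using h2
  rw [integral_sub (integrable_eval_gaussian _) (integrable_eval_gaussian _)] at h3
  simp only [Polynomial.eval_mul, Polynomial.eval_X] at h3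
  linarith

/-- The raising operator `h ↦ x h - h'` is the adjoint of differentiation in `L²` of the Gaussian.
Iterating this yields orthogonality. -/
theorem integral_hermiteReal_succ_mul (n : ℕ) (q : Polynomial ℝ) :
    ∫ x, (hermiteReal (n + 1)).eval x * q.eval x ∂(gaussianReal 0 1) =
      ∫ x, (hermiteReal n).eval x * (Polynomial.derivative q).eval x ∂(gaussianReal 0 1) := by
  have h := integral_mul_eval_gaussian (hermiteReal n * q)
  have e1 : ∀ x, (hermiteReal (n + 1)).eval x * q.eval x =
      (Polynomial.X * (hermiteReal n * q)).eval x -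
        (Polynomial.derivative (hermiteReal n) * q).eval x := by
    intro x; rw [hermiteReal_succ]; simp; ring
  have e2 : ∀ x, (Polynomial.derivative (hermiteReal n * q)).eval x =
      (Polynomial.derivative (hermiteReal n) * q).eval x +
        (hermiteReal n * Polynomial.derivative q).eval x := by
    intro x; simp
  simp_rw [e1]
  rw [integral_sub (integrable_eval_gaussian _) (integrable_eval_gaussian _)]
  simp_rw [e2] at h
  rw [integral_add (integrable_eval_gaussian _) (integrable_eval_gaussian _)] at h
  simp only [Polynomial.eval_mul, Polynomial.eval_X] at h ⊢
  linarith

/-- Orthogonality of the Hermite polynomials. -/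
theorem integral_hermiteReal_mul (a b : ℕ) :
    ∫ x, (hermiteReal a).eval x * (hermiteReal b).eval x ∂(gaussianReal 0 1) =
      if a = b then (a.factorial : ℝ) else 0 := by
  induction a generalizing b with
  | zero =>
    cases b with
    | zero => simp [hermiteReal_zero]
    | succ b =>
      simp_rw [mul_comm ((hermiteReal 0).eval _)]
      rw [integral_hermiteReal_succ_mul]
      simp [hermiteReal_zero]
  | succ a ih =>
    rw [integral_hermiteReal_succ_mul]
    cases b with
    | zero => simp [hermiteReal_zero]
    | succ b =>
      simp_rw [derivative_hermiteReal_succ, Polynomial.eval_smul, smul_eq_mul,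
        mul_left_comm _ ((b : ℝ) + 1)]
      rw [integral_const_mul, ih]
      by_cases h : a = b
      · subst h; simp [Nat.factorial_succ]
      · simp [h]

/-- The Gaussian average of a shifted Hermite polynomial is a monomial in the shift. -/
theorem integral_hermiteReal_add (a : ℕ) (u : ℝ) :
    ∫ x, (hermiteReal a).eval (x + u) ∂(gaussianReal 0 1) = u ^ a := by
  induction a with
  | zero => simp [hermiteReal_zero]
  | succ a ih =>
    set g := (hermiteReal a).comp (Polynomial.X + Polynomial.C u) with hg
    have h := integral_mul_eval_gaussian g
    -- The part `x g - g'` integrates to zero by parts, so each raising step contributes exactly one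
    -- factor `u`.
    have e1 : ∀ x, (hermiteReal (a + 1)).eval (x + u) =
        (Polynomial.X * g - Polynomial.derivative g).eval x + u * g.eval x := by
      intro x; rw [hermiteReal_succ, hg, Polynomial.derivative_comp]; simp; ring
    have e3 : ∫ x, g.eval x ∂(gaussianReal 0 1) = u ^ a := by rw [← ih]; simp [hg]
    simp_rw [e1]
    rw [integral_add (integrable_eval_gaussian _) ((integrable_eval_gaussian _).const_mul _),
      integral_const_mul, e3]
    simp_rw [Polynomial.eval_sub]
    rw [integral_sub (integrable_eval_gaussian _) (integrable_eval_gaussian _)]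
    simp only [Polynomial.eval_mul, Polynomial.eval_X]
    rw [h]; ring

end Hermite

/-! ### Hermite polynomials in several variables as a basis. -/

section MvHermite

variable {σ : Type*} [Fintype σ]

/-- The Hermite polynomial in several variables with multidegree `α`. -/
noncomputable def mvHermite (α : σ → ℕ) : MvPolynomial σ ℝ :=
  ∏ i, Polynomial.aeval (MvPolynomial.X i) (hermiteReal (α i))

theorem eval_mvHermite (α : σ → ℕ) (x : σ → ℝ) :
    MvPolynomial.eval x (mvHermite α) = ∏ i, (hermiteReal (α i)).eval (x i) := by
  rw [mvHermite, map_prod]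
  refine Finset.prod_congr rfl fun i _ => ?_
  rw [← MvPolynomial.coe_aeval_eq_eval, RingHom.coe_coe, ← Polynomial.aeval_algHom_apply]
  simp [Polynomial.aeval_def, Polynomial.eval₂_eq_eval_map]

theorem mvHermite_zero : mvHermite (0 : σ → ℕ) = 1 := by
  simp [mvHermite, hermiteReal_zero]

theorem totalDegree_mvHermite_le (α : σ → ℕ) : (mvHermite α).totalDegree ≤ ∑ i, α i := by
  refine (MvPolynomial.totalDegree_finsetProd _ _).trans (Finset.sum_le_sum fun i _ => ?_)
  rw [Polynomial.aeval_eq_sum_range]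
  refine MvPolynomial.totalDegree_finsetSum_le fun k hk => ?_
  refine (MvPolynomial.totalDegree_smul_le _ _).trans ?_
  rw [MvPolynomial.totalDegree_X_pow]
  have := natDegree_hermiteReal_le (α i)
  have := Finset.mem_range.1 hk
  omega

/-- The span of the Hermite polynomials of degree at most `D`. -/
noncomputable def hermiteSpan (σ : Type*) [Fintype σ] (D : ℕ) :
    Submodule ℝ (MvPolynomial σ ℝ) :=
  Submodule.span ℝ (mvHermite '' {α : σ → ℕ | ∑ i, α i ≤ D})

theorem mvHermite_mem_hermiteSpan {α : σ → ℕ} {D : ℕ} (h : ∑ i, α i ≤ D) :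
    mvHermite α ∈ hermiteSpan σ D :=
  Submodule.subset_span ⟨α, h, rfl⟩

section Update

variable [DecidableEq σ]

theorem mvHermite_eq_mul_prod_erase (α : σ → ℕ) (i : σ) :
    mvHermite α = Polynomial.aeval (MvPolynomial.X i) (hermiteReal (α i)) *
      ∏ j ∈ Finset.univ.erase i, Polynomial.aeval (MvPolynomial.X j) (hermiteReal (α j)) :=
  (Finset.mul_prod_erase _ _ (Finset.mem_univ i)).symm

theorem mvHermite_update (α : σ → ℕ) (i : σ) (k : ℕ) :
    mvHermite (Function.update α i k) =
      Polynomial.aeval (MvPolynomial.X i) (hermiteReal k) *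
      ∏ j ∈ Finset.univ.erase i, Polynomial.aeval (MvPolynomial.X j) (hermiteReal (α j)) := by
  rw [mvHermite_eq_mul_prod_erase _ i, Function.update_self]
  congr 1
  refine Finset.prod_congr rfl fun j hj => ?_
  rw [Function.update_of_ne (Finset.ne_of_mem_erase hj)]

theorem sum_update_add (α : σ → ℕ) (i : σ) (k : ℕ) :
    (∑ j, Function.update α i k j) + α i = (∑ j, α j) + k := by
  rw [Finset.sum_update_of_mem (Finset.mem_univ i), ← Finset.add_sum_erase _ α (Finset.mem_univ i),
    Finset.sdiff_singleton_eq_erase]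
  ring

/-- The three-term recurrence in the variable `i` rewrites the product as Hermite polynomials whose
`i`-th index has moved by one. Monomials are then reached one variable at a time. -/
theorem X_mul_mem_hermiteSpan {D : ℕ} (i : σ) {f : MvPolynomial σ ℝ} (hf : f ∈ hermiteSpan σ D) :
    MvPolynomial.X i * f ∈ hermiteSpan σ (D + 1) := by
  induction hf using Submodule.span_induction with
  | zero => simp
  | add f g _ _ hf hg => rw [mul_add]; exact Submodule.add_mem _ hf hg
  | smul a f _ hf => rw [mul_smul_comm]; exact Submodule.smul_mem _ _ hf
  | mem f hf =>
    obtain ⟨α, hα, rfl⟩ := hf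
    have hα' : ∑ i, α i ≤ D := hα
    have hX : ∀ q : Polynomial ℝ, (MvPolynomial.X i : MvPolynomial σ ℝ) *
        Polynomial.aeval (MvPolynomial.X i) q =
        Polynomial.aeval (MvPolynomial.X i) (Polynomial.X * q) := by
      intro q; simp
    rw [mvHermite_eq_mul_prod_erase α i, ← mul_assoc, hX]
    have hu := sum_update_add α i
    cases h : α i with
    | zero =>
      have e : Polynomial.X * hermiteReal 0 = hermiteReal 1 := by
        simp [hermiteReal_succ, hermiteReal_zero]
      rw [e, ← mvHermite_update]
      refine mvHermite_mem_hermiteSpan ?_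
      have := hu 1
      omega
    | succ k =>
      rw [X_mul_hermiteReal_succ, map_add, map_smul, add_mul, smul_mul_assoc, ← mvHermite_update,
        ← mvHermite_update]
      refine Submodule.add_mem _ (mvHermite_mem_hermiteSpan ?_)
        (Submodule.smul_mem _ _ (mvHermite_mem_hermiteSpan ?_))
      · have := hu (k + 2)
        omega
      · have := hu k
        omega

end Update

theorem hermiteSpan_mono {D D' : ℕ} (h : D ≤ D') : hermiteSpan σ D ≤ hermiteSpan σ D' :=
  Submodule.span_mono (Set.image_mono fun _ hα => le_trans (Set.mem_ofPred.1 hα) h)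

theorem mem_hermiteSpan_of_totalDegree_le {D : ℕ} {f : MvPolynomial σ ℝ}
    (hf : f.totalDegree ≤ D) : f ∈ hermiteSpan σ D := by
  classical
  have key : ∀ (d : ℕ) (m : σ →₀ ℕ), m.degree = d →
      MvPolynomial.monomial m (1 : ℝ) ∈ hermiteSpan σ d := by
    intro d
    induction d with
    | zero =>
      intro m hm
      rw [Finsupp.degree_eq_zero_iff] at hm
      subst hm
      have := mvHermite_mem_hermiteSpan (α := (0 : σ → ℕ)) (D := 0) (by simp)
      rwa [mvHermite_zero] at this
    | succ d ih =>
      intro m hm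
      have hne : m ≠ 0 := by
        rintro rfl
        simp at hm
      obtain ⟨i, hi⟩ := Finsupp.ne_iff.1 hne
      have hle : Finsupp.single i 1 ≤ m := by
        rw [Finsupp.single_le_iff]
        exact Nat.one_le_iff_ne_zero.2 hi
      have hs : Finsupp.single i 1 + (m - Finsupp.single i 1) = m := add_tsub_cancel_of_le hle
      have hd : (m - Finsupp.single i 1).degree = d := by
        have := congrArg Finsupp.degree hs
        rw [map_add, Finsupp.degree_single] at this
        omega
      have := X_mul_mem_hermiteSpan i (ih _ hd)
      rwa [MvPolynomial.X, MvPolynomial.monomial_mul, hs, one_mul] at this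
  rw [f.as_sum]
  refine Submodule.sum_mem _ fun m hm => ?_
  have h1 : m.degree ≤ D := (MvPolynomial.le_totalDegree hm).trans hf
  have h2 := Submodule.smul_mem _ (f.coeff m) (hermiteSpan_mono h1 (key _ m rfl))
  rwa [MvPolynomial.smul_monomial, smul_eq_mul, mul_one] at h2

/-- The multidegrees of total degree at most `D`. -/
def multidegrees (σ : Type*) [Fintype σ] [DecidableEq σ] (D : ℕ) : Finset (σ → ℕ) :=
  (Finset.range (D + 1)).biUnion fun d => Finset.piAntidiag Finset.univ d

theorem mem_multidegrees [DecidableEq σ] {D : ℕ} {α : σ → ℕ} :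
    α ∈ multidegrees σ D ↔ ∑ i, α i ≤ D := by
  simp [multidegrees]

theorem exists_eq_sum_mvHermite [DecidableEq σ] {D : ℕ} {f : MvPolynomial σ ℝ}
    (hf : f.totalDegree ≤ D) :
    ∃ c : (σ → ℕ) → ℝ, f = ∑ α ∈ multidegrees σ D, c α • mvHermite α := by
  have h := mem_hermiteSpan_of_totalDegree_le hf
  have e : {α : σ → ℕ | ∑ i, α i ≤ D} = (multidegrees σ D : Set (σ → ℕ)) := by
    ext α; simp [mem_multidegrees]
  rw [hermiteSpan, e, Submodule.mem_span_image_finset_iff_exists_fun] at h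
  obtain ⟨c, hc⟩ := h
  refine ⟨fun α => if h : α ∈ multidegrees σ D then c ⟨α, h⟩ else 0, ?_⟩
  rw [← hc, ← Finset.sum_coe_sort (multidegrees σ D)]
  simp

/-- Polynomials are integrable against a standard Gaussian vector. -/
theorem integrable_eval_pi_gaussian (f : MvPolynomial σ ℝ) :
    Integrable (fun x => MvPolynomial.eval x f) (Measure.pi fun _ : σ => gaussianReal 0 1) := by
  obtain ⟨D, hf⟩ : ∃ D, f ∈ hermiteSpan σ D :=
    ⟨_, mem_hermiteSpan_of_totalDegree_le le_rfl⟩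
  induction hf using Submodule.span_induction with
  | zero => simp
  | add f g _ _ hf hg =>
    simp only [map_add]
    exact hf.add hg
  | smul a f _ hf =>
    simp only [MvPolynomial.smul_eval]
    exact hf.const_mul a
  | mem f hf =>
    obtain ⟨α, -, rfl⟩ := hf
    simp_rw [eval_mvHermite]
    exact Integrable.fintype_prod (f := fun i x => (hermiteReal (α i)).eval x)
      fun i => integrable_eval_gaussian _

theorem integral_mvHermite_mul (α β : σ → ℕ) :
    ∫ x, MvPolynomial.eval x (mvHermite α) * MvPolynomial.eval x (mvHermite β)
      ∂(Measure.pi fun _ : σ => gaussianReal 0 1) =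
      if α = β then ∏ i, ((α i).factorial : ℝ) else 0 := by
  simp_rw [eval_mvHermite, ← Finset.prod_mul_distrib]
  rw [integral_fintype_prod_eq_prod
    (fun i x => (hermiteReal (α i)).eval x * (hermiteReal (β i)).eval x)]
  simp_rw [integral_hermiteReal_mul]
  split_ifs with h
  · subst h; simp
  · obtain ⟨i, hi⟩ := Function.ne_iff.1 h
    exact Finset.prod_eq_zero (Finset.mem_univ i) (if_neg hi)

theorem integral_mvHermite_add (α : σ → ℕ) (u : σ → ℝ) :
    ∫ x, MvPolynomial.eval (x + u) (mvHermite α) ∂(Measure.pi fun _ : σ => gaussianReal 0 1) =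
      ∏ i, u i ^ α i := by
  simp_rw [eval_mvHermite, Pi.add_apply]
  rw [integral_fintype_prod_eq_prod (fun i x => (hermiteReal (α i)).eval (x + u i))]
  simp_rw [integral_hermiteReal_add]

end MvHermite

/-! ### The low-degree norm as a sum over Hermite moments, and Gaussian mixtures. -/

section Norm

variable {σ : Type*} [Fintype σ]

/-- The low-degree norm is the Euclidean norm of the vector of normalised Hermite moments, and the
supremum that defines it is attained. -/
theorem isGreatest_lowDegreeRatios [DecidableEq σ] (P : Measure (σ → ℝ)) [IsProbabilityMeasure P]
    (hP : ∀ f : MvPolynomial σ ℝ, Integrable (fun x => MvPolynomial.eval x f) P) (D : ℕ) :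
    IsGreatest (lowDegreeRatios P (Measure.pi fun _ : σ => gaussianReal 0 1) D)
      (√(∑ α ∈ multidegrees σ D,
        (∫ x, MvPolynomial.eval x (mvHermite α) ∂P) ^ 2 / ∏ i, ((α i).factorial : ℝ))) := by
  set Q := Measure.pi fun _ : σ => gaussianReal 0 1 with hQ
  set m : (σ → ℕ) → ℝ := fun α => ∫ x, MvPolynomial.eval x (mvHermite α) ∂P with hm
  set w : (σ → ℕ) → ℝ := fun α => ∏ i, ((α i).factorial : ℝ) with hw
  have hwpos : ∀ α, 0 < w α := fun α => Finset.prod_pos fun i _ => by positivity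
  have heval : ∀ (c : (σ → ℕ) → ℝ) x, MvPolynomial.eval x
      (∑ α ∈ multidegrees σ D, c α • mvHermite α) =
      ∑ α ∈ multidegrees σ D, c α * MvPolynomial.eval x (mvHermite α) := by
    intro c x; simp [map_sum, MvPolynomial.smul_eval]
  have hPint : ∀ c : (σ → ℕ) → ℝ, ∫ x, MvPolynomial.eval x
      (∑ α ∈ multidegrees σ D, c α • mvHermite α) ∂P = ∑ α ∈ multidegrees σ D, c α * m α := by
    intro c
    simp_rw [heval]
    rw [integral_finsetSum _ fun α _ => (hP _).const_mul _]
    simp_rw [integral_const_mul, hm]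
  have hQint : ∀ c : (σ → ℕ) → ℝ, ∫ x, (MvPolynomial.eval x
      (∑ α ∈ multidegrees σ D, c α • mvHermite α)) ^ 2 ∂Q =
      ∑ α ∈ multidegrees σ D, c α ^ 2 * w α := by
    intro c
    have hint : ∀ α β : σ → ℕ, Integrable (fun x => MvPolynomial.eval x (mvHermite α) *
        MvPolynomial.eval x (mvHermite β)) Q := by
      intro α β
      simpa using integrable_eval_pi_gaussian (mvHermite α * mvHermite β)
    simp_rw [heval, sq, Finset.sum_mul_sum, mul_mul_mul_comm]
    rw [integral_finsetSum _ fun α _ => integrable_finsetSum _ fun β _ => (hint α β).const_mul _]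
    refine Finset.sum_congr rfl fun α hα => ?_
    rw [integral_finsetSum _ fun β _ => (hint α β).const_mul _]
    simp_rw [integral_const_mul, hQ, integral_mvHermite_mul]
    simp [hα, hw]
  have hzero : (0 : σ → ℕ) ∈ multidegrees σ D := by simp [mem_multidegrees]
  have hm0 : m 0 = 1 := by simp [hm, mvHermite_zero]
  set B := ∑ α ∈ multidegrees σ D, m α ^ 2 / w α with hB
  -- The constant polynomial has moment 1, so the extremal polynomial below has positive second
  -- moment and is admissible.
  have hBpos : 0 < B := by
    refine Finset.sum_pos' (fun α _ => div_nonneg (sq_nonneg _) (hwpos α).le) ⟨0, hzero, ?_⟩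
    rw [hm0]
    exact div_pos (by norm_num) (hwpos 0)
  constructor
  -- The equality case of Cauchy–Schwarz: both its mean under `P` and its second moment under `Q`
  -- equal `B`.
  · refine ⟨∑ α ∈ multidegrees σ D, (m α / w α) • mvHermite α,
      MvPolynomial.totalDegree_finsetSum_le fun α hα =>
        (MvPolynomial.totalDegree_smul_le _ _).trans ((totalDegree_mvHermite_le α).trans
          (mem_multidegrees.1 hα)), ?_⟩
    have e1 : ∑ α ∈ multidegrees σ D, (m α / w α) ^ 2 * w α = B := by
      refine Finset.sum_congr rfl fun α _ => ?_
      have := (hwpos α).ne'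
      field_simp
    have e2 : ∑ α ∈ multidegrees σ D, (m α / w α) * m α = B := by
      refine Finset.sum_congr rfl fun α _ => ?_
      ring
    rw [hQint, hPint, e1, e2]
    exact ⟨hBpos, (Real.div_sqrt).symm⟩
  · rintro r ⟨f, hf, hpos, rfl⟩
    obtain ⟨c, rfl⟩ := exists_eq_sum_mvHermite hf
    rw [hQint] at hpos ⊢
    rw [hPint, div_le_iff₀ (Real.sqrt_pos.2 hpos), ← Real.sqrt_mul hBpos.le]
    refine Real.le_sqrt_of_sq_le ?_
    rw [mul_comm B]
    -- Weighted Cauchy–Schwarz, with `c α * m α` split into `c α * √(w α)` and `m α / √(w α)`.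
    refine Finset.sum_sq_le_sum_mul_sum_of_sq_le_mul _ (fun α _ => ?_) (fun α _ => ?_)
      fun α _ => ?_
    · exact mul_nonneg (sq_nonneg _) (hwpos α).le
    · exact div_nonneg (sq_nonneg _) (hwpos α).le
    · refine le_of_eq ?_
      have := (hwpos α).ne'
      field_simp

theorem sum_multidegrees [DecidableEq σ] {M : Type*} [AddCommMonoid M] (D : ℕ) (f : (σ → ℕ) → M) :
    ∑ α ∈ multidegrees σ D, f α =
      ∑ d ∈ Finset.range (D + 1), ∑ α ∈ Finset.piAntidiag Finset.univ d, f α := by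
  rw [multidegrees, Finset.sum_biUnion]
  intro a _ b _ hab
  rw [Function.onFun, Finset.disjoint_left]
  intro α ha hb
  simp only [Finset.mem_piAntidiag] at ha hb
  exact hab (ha.1.symm.trans hb.1)

theorem sum_prod_pow_div_factorial [DecidableEq σ] (d : ℕ) (x : σ → ℝ) :
    ∑ α ∈ Finset.piAntidiag Finset.univ d, (∏ i, x i ^ α i) / ∏ i, ((α i).factorial : ℝ) =
      (∑ i, x i) ^ d / d.factorial := by
  rw [Finset.sum_pow_eq_sum_piAntidiag, Finset.sum_div]
  refine Finset.sum_congr rfl fun α hα => ?_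
  have h := Nat.multinomial_spec Finset.univ α
  rw [(Finset.mem_piAntidiag.1 hα).1] at h
  have h' : (∏ i, ((α i).factorial : ℝ)) * Nat.multinomial Finset.univ α = d.factorial := by
    exact_mod_cast h
  have hw : (∏ i, ((α i).factorial : ℝ)) ≠ 0 :=
    Finset.prod_ne_zero_iff.2 fun i _ => by positivity
  have hd : (d.factorial : ℝ) ≠ 0 := by positivity
  rw [div_eq_div_iff hw hd, ← h']
  ring

variable {K : Type*} [Fintype K]

/-- The mixture with equal weights `w` of the standard Gaussian laws with means `u k`. -/
noncomputable def gaussianMixture (w : ENNReal) (u : K → σ → ℝ) : Measure (σ → ℝ) :=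
  ∑ k, w • (Measure.pi fun _ : σ => gaussianReal 0 1).map fun x => x + u k

theorem integrable_eval_add (f : MvPolynomial σ ℝ) (u : σ → ℝ) :
    Integrable (fun x => MvPolynomial.eval (x + u) f)
      (Measure.pi fun _ : σ => gaussianReal 0 1) := by
  -- The shifted polynomial is again a polynomial, obtained by substituting `X i + u i`.
  have h := integrable_eval_pi_gaussian
    (MvPolynomial.bind₁ (fun i => MvPolynomial.X i + MvPolynomial.C (u i)) f)
  refine h.congr (Filter.Eventually.of_forall fun x => ?_)
  simp only [MvPolynomial.eval, MvPolynomial.eval₂Hom_bind₁]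
  congr 2
  ext i
  simp

theorem integrable_eval_map_add (f : MvPolynomial σ ℝ) (u : σ → ℝ) :
    Integrable (fun x => MvPolynomial.eval x f)
      ((Measure.pi fun _ : σ => gaussianReal 0 1).map fun x => x + u) := by
  rw [integrable_map_measure (MvPolynomial.continuous_eval f).aestronglyMeasurable
    (by fun_prop)]
  exact integrable_eval_add f u

theorem integrable_eval_gaussianMixture {w : ENNReal} (hw : w ≠ ⊤) (u : K → σ → ℝ)
    (f : MvPolynomial σ ℝ) :
    Integrable (fun x => MvPolynomial.eval x f) (gaussianMixture w u) :=
  integrable_finsetSum_measure.2 fun k _ => (integrable_eval_map_add f (u k)).smul_measure hw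

theorem integral_mvHermite_gaussianMixture {w : ENNReal} (hw : w ≠ ⊤) (u : K → σ → ℝ)
    (α : σ → ℕ) :
    ∫ x, MvPolynomial.eval x (mvHermite α) ∂(gaussianMixture w u) =
      w.toReal * ∑ k, ∏ i, u k i ^ α i := by
  rw [gaussianMixture, integral_finsetSum_measure fun k _ =>
    (integrable_eval_map_add _ (u k)).smul_measure hw, Finset.mul_sum]
  refine Finset.sum_congr rfl fun k _ => ?_
  rw [integral_smul_measure, integral_map (by fun_prop)
    (MvPolynomial.continuous_eval _).aestronglyMeasurable, integral_mvHermite_add, smul_eq_mul]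

/-- Squaring a moment introduces a second, independent copy of the shift; the multinomial theorem
then collects all multidegrees of total degree `d` into a power of the inner product of the two
shifts. -/
theorem sum_sq_integral_mvHermite_gaussianMixture [DecidableEq σ] {w : ENNReal} (hw : w ≠ ⊤) (u : K → σ → ℝ)
    (D : ℕ) :
    ∑ α ∈ multidegrees σ D, (∫ x, MvPolynomial.eval x (mvHermite α) ∂(gaussianMixture w u)) ^ 2 /
        ∏ i, ((α i).factorial : ℝ) =
      ∑ d ∈ Finset.range (D + 1), w.toReal ^ 2 *
        (∑ k, ∑ l, (∑ i, u k i * u l i) ^ d) / d.factorial := by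
  rw [sum_multidegrees]
  refine Finset.sum_congr rfl fun d _ => ?_
  simp_rw [integral_mvHermite_gaussianMixture hw, mul_pow, mul_div_assoc]
  rw [← Finset.mul_sum]
  congr 1
  simp_rw [Finset.sum_div, ← sum_prod_pow_div_factorial]
  simp_rw [sq, Finset.sum_mul_sum, Finset.sum_div, ← Finset.prod_mul_distrib, ← mul_pow]
  rw [Finset.sum_comm]
  refine Finset.sum_congr rfl fun k _ => ?_
  rw [Finset.sum_comm]

end Norm

/-! ### Moments of sums of independent signs. -/

section Signs

/-- The sign `±1` encoded by a Boolean. -/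
def boolSign (b : Bool) : ℝ := if b then 1 else -1

theorem boolSign_not (b : Bool) : boolSign (!b) = -boolSign b := by
  cases b <;> simp [boolSign]

variable {ι : Type*} [Fintype ι] [DecidableEq ι]

/-- The average of the `d`-th power of a sum of independent signs indexed by `T`. -/
noncomputable def signMoment (T : Finset ι) (d : ℕ) : ℝ :=
  (2⁻¹ : ℝ) ^ Fintype.card ι * ∑ b : ι → Bool, (∑ i ∈ T, boolSign (b i)) ^ d

theorem signMoment_of_odd (T : Finset ι) {d : ℕ} (hd : Odd d) : signMoment T d = 0 := by
  have h : ∑ b : ι → Bool, (∑ i ∈ T, boolSign (b i)) ^ d =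
      -∑ b : ι → Bool, (∑ i ∈ T, boolSign (b i)) ^ d := by
    conv_lhs => rw [← (Equiv.arrowCongr (Equiv.refl ι) Equiv.boolNot).sum_comp]
    rw [← Finset.sum_neg_distrib]
    refine Finset.sum_congr rfl fun b _ => ?_
    simp [boolSign_not, hd.neg_pow]
  rw [signMoment, show ∑ b : ι → Bool, (∑ i ∈ T, boolSign (b i)) ^ d = 0 by linarith, mul_zero]

theorem signMoment_zero_right (T : Finset ι) : signMoment T 0 = 1 := by
  simp [signMoment]

theorem signMoment_nonneg_of_even (T : Finset ι) {d : ℕ} (hd : Even d) : 0 ≤ signMoment T d :=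
  mul_nonneg (by positivity) (Finset.sum_nonneg fun _ _ => hd.pow_nonneg _)

/-- Flipping the signs in a fixed pattern does not change the moments. -/
theorem signMoment_eq_mul (T : Finset ι) (d : ℕ) (a : ι → Bool) :
    (2⁻¹ : ℝ) ^ Fintype.card ι * ∑ b : ι → Bool, (∑ i ∈ T, boolSign (a i) * boolSign (b i)) ^ d =
      signMoment T d := by
  rw [signMoment]
  congr 1
  -- As `true` encodes `+1`, multiplication of signs is the negated `xor`.
  have hinv : Function.Involutive fun (b : ι → Bool) i => !(xor (a i) (b i)) := by
    intro b; ext i; cases h : a i <;> cases h' : b i <;> simp [h, h']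
  rw [← Equiv.sum_comp (hinv.toPerm _)]
  refine Finset.sum_congr rfl fun b _ => ?_
  congr 1
  refine Finset.sum_congr rfl fun i _ => ?_
  simp only [Function.Involutive.coe_toPerm]
  cases a i <;> cases b i <;> simp [boolSign]

theorem two_pow_mul_factorial_le (k : ℕ) : 2 ^ k * k.factorial ≤ (2 * k).factorial := by
  induction k with
  | zero => simp
  | succ k ih =>
    rw [show 2 * (k + 1) = 2 * k + 1 + 1 by ring, Nat.factorial_succ, Nat.factorial_succ,
      Nat.factorial_succ]
    calc 2 ^ (k + 1) * ((k + 1) * k.factorial) = (2 * k + 2) * (1 * (2 ^ k * k.factorial)) := by ring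
      _ ≤ (2 * k + 1 + 1) * ((2 * k + 1) * (2 * k).factorial) := by gcongr; omega

/-- Pairing each sign pattern with its flip at `i` averages out the new sign and leaves the sum over
`T` untouched. -/
theorem signMoment_insert_eq_sum {T : Finset ι} {i : ι} (hi : i ∉ T) (d : ℕ) :
    signMoment (insert i T) d =
      2⁻¹ * ((2⁻¹ : ℝ) ^ Fintype.card ι * ∑ b : ι → Bool, ((∑ j ∈ T, boolSign (b j) + 1) ^ d +
        (∑ j ∈ T, boolSign (b j) - 1) ^ d)) := by
  set g : (ι → Bool) → ℝ := fun b => (∑ j ∈ insert i T, boolSign (b j)) ^ d with hg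
  have hinv : Function.Involutive fun b : ι → Bool => Function.update b i (!b i) := by
    intro b; simp
  have h1 : ∑ b, g b = ∑ b, g (hinv.toPerm _ b) :=
    (Equiv.sum_comp (hinv.toPerm _) g).symm
  have h2 : ∀ b, g b + g (hinv.toPerm _ b) = (∑ j ∈ T, boolSign (b j) + 1) ^ d +
        (∑ j ∈ T, boolSign (b j) - 1) ^ d := by
    intro b
    have e : ∑ j ∈ T, boolSign (Function.update b i (!b i) j) = ∑ j ∈ T, boolSign (b j) := by
      refine Finset.sum_congr rfl fun j hj => ?_
      rw [Function.update_of_ne]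
      rintro rfl
      exact hi hj
    simp only [hg, Function.Involutive.coe_toPerm, Finset.sum_insert hi, e, Function.update_self]
    cases b i <;> simp [boolSign] <;> ring
  have h3 : ∑ b, g b + ∑ b, g b = ∑ b : ι → Bool, ((∑ j ∈ T, boolSign (b j) + 1) ^ d +
        (∑ j ∈ T, boolSign (b j) - 1) ^ d) := by
    nth_rewrite 2 [h1]
    rw [← Finset.sum_add_distrib]
    exact Finset.sum_congr rfl fun b _ => h2 b
  rw [signMoment, ← h3]
  ring

theorem sum_range_two_mul_add_one {M : Type*} [AddCommMonoid M] (f : ℕ → M)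
    (hf : ∀ j, f (2 * j + 1) = 0) (k : ℕ) :
    ∑ m ∈ Finset.range (2 * k + 1), f m = ∑ j ∈ Finset.range (k + 1), f (2 * j) := by
  induction k with
  | zero => simp
  | succ k ih =>
    rw [Finset.sum_range_succ _ (k + 1), ← ih, show 2 * (k + 1) + 1 = 2 * k + 1 + 1 + 1 by ring,
      Finset.sum_range_succ, Finset.sum_range_succ, hf, add_zero]
    rfl

theorem half_add_pow_add_sub_pow (x : ℝ) (k : ℕ) :
    2⁻¹ * ((x + 1) ^ (2 * k) + (x - 1) ^ (2 * k)) =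
      ∑ j ∈ Finset.range (k + 1), x ^ (2 * j) * ((2 * k).choose (2 * j) : ℝ) := by
  rw [sub_eq_add_neg, add_pow, add_pow, ← Finset.sum_add_distrib, Finset.mul_sum,
    sum_range_two_mul_add_one]
  · refine Finset.sum_congr rfl fun j hj => ?_
    have : j ≤ k := Nat.lt_succ_iff.1 (Finset.mem_range.1 hj)
    rw [(show Even (2 * k - 2 * j) from ⟨k - j, by omega⟩).neg_one_pow]
    ring
  · intro j
    rcases Nat.lt_or_ge (2 * k) (2 * j + 1) with h | h
    · simp [Nat.choose_eq_zero_of_lt h]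
    · rw [(show Odd (2 * k - (2 * j + 1)) from ⟨k - j - 1, by omega⟩).neg_one_pow]
      ring

theorem signMoment_insert {T : Finset ι} {i : ι} (hi : i ∉ T) (k : ℕ) :
    signMoment (insert i T) (2 * k) =
      ∑ j ∈ Finset.range (k + 1), signMoment T (2 * j) * ((2 * k).choose (2 * j) : ℝ) := by
  rw [signMoment_insert_eq_sum hi, mul_left_comm, Finset.mul_sum]
  simp_rw [half_add_pow_add_sub_pow, signMoment]
  rw [Finset.sum_comm, Finset.mul_sum]
  refine Finset.sum_congr rfl fun j _ => ?_
  rw [← Finset.sum_mul, mul_assoc]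

/-- The even moments of a sum of independent signs are at most those of a Gaussian variable of the
same variance. -/
theorem signMoment_le (T : Finset ι) (k : ℕ) :
    signMoment T (2 * k) ≤ (2 * k).factorial / (2 ^ k * k.factorial) * (T.card : ℝ) ^ k := by
  induction T using Finset.induction_on generalizing k with
  | empty =>
    cases k with
    | zero => simp [signMoment_zero_right]
    | succ k => simp [signMoment]
  | insert i T hi ih =>
    rw [signMoment_insert hi, Finset.card_insert_of_notMem hi]
    push_cast
    -- Both sides are now binomial sums over `j`, compared term by term. After cancellation, only
    -- `2^m * m! ≤ (2m)!` with `m = k - j` is needed: the moment 1 of a single sign is at most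
    -- `(2m-1)!!`.
    rw [add_pow, Finset.mul_sum]
    refine Finset.sum_le_sum fun j hj => ?_
    have hjk : j ≤ k := Nat.lt_succ_iff.1 (Finset.mem_range.1 hj)
    refine (mul_le_mul_of_nonneg_right (ih j) (by positivity)).trans ?_
    rw [Nat.cast_choose ℝ hjk, Nat.cast_choose ℝ (show 2 * j ≤ 2 * k by omega),
      show 2 * k - 2 * j = 2 * (k - j) by omega, one_pow, mul_one]
    have h1 : (2 : ℝ) ^ (k - j) * (k - j).factorial ≤ (2 * (k - j)).factorial := by
      exact_mod_cast two_pow_mul_factorial_le (k - j)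
    have h2 : (2 : ℝ) ^ k = 2 ^ j * 2 ^ (k - j) := by rw [← pow_add]; congr 1; omega
    have e1 : ((2 * j).factorial : ℝ) / (2 ^ j * j.factorial) * (T.card : ℝ) ^ j *
        ((2 * k).factorial / ((2 * j).factorial * (2 * (k - j)).factorial)) =
        ((2 * k).factorial * (T.card : ℝ) ^ j / (2 ^ j * j.factorial)) *
          (1 / (2 * (k - j)).factorial) := by
      field_simp
    have e2 : ((2 * k).factorial : ℝ) / (2 ^ k * k.factorial) *
        ((T.card : ℝ) ^ j * (k.factorial / (j.factorial * (k - j).factorial))) =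
        ((2 * k).factorial * (T.card : ℝ) ^ j / (2 ^ j * j.factorial)) *
          (1 / (2 ^ (k - j) * (k - j).factorial)) := by
      rw [h2]
      field_simp
    rw [e1, e2]
    gcongr

end Signs

/-! ### Moments of the overlap of two random supports. -/

section Hypergeometric

variable {p : ℕ}

theorem card_powersetCard_superset (s : ℕ) (T : Finset (Fin p)) (hT : T.card ≤ s) :
    (((Finset.univ : Finset (Fin p)).powersetCard s).filter (T ⊆ ·)).card =
      (p - T.card).choose (s - T.card) := by
  have h : (((Finset.univ : Finset (Fin p)).powersetCard s).filter (T ⊆ ·)) =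
      (Tᶜ.powersetCard (s - T.card)).image (T ∪ ·) := by
    ext S
    simp only [Finset.mem_filter, Finset.mem_powersetCard, Finset.subset_univ, true_and,
      Finset.mem_image]
    constructor
    · rintro ⟨hc, hTS⟩
      refine ⟨S \ T, ⟨?_, ?_⟩, Finset.union_sdiff_of_subset hTS⟩
      · intro x hx
        simp only [Finset.mem_sdiff] at hx
        simpa using hx.2
      · rw [Finset.card_sdiff_of_subset hTS, hc]
    · rintro ⟨R, ⟨hR, hc⟩, rfl⟩
      refine ⟨?_, Finset.subset_union_left⟩
      rw [Finset.card_union_of_disjoint, hc]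
      · omega
      · exact Finset.disjoint_left.2 fun x hx hx' => by simpa [hx] using hR hx'
  rw [h, Finset.card_image_of_injOn, Finset.card_powersetCard, Finset.card_compl, Fintype.card_fin]
  intro R hR R' hR' hEq
  have key : ∀ {R : Finset (Fin p)}, R ⊆ Tᶜ → (T ∪ R) \ T = R := by
    intro R hR
    ext x
    have := @hR x
    simp only [Finset.mem_compl] at this
    simp only [Finset.mem_sdiff, Finset.mem_union]
    tauto
  rw [← key (Finset.mem_powersetCard.1 hR).1, ← key (Finset.mem_powersetCard.1 hR').1]
  exact congrArg (· \ T) hEq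

/-- A fixed `j`-set lies in a uniform `s`-set with probability `∏_{i<j} (s-i)/(p-i)`, and each
factor is at most `s/p`. -/
theorem choose_sub_mul_pow_le {p s : ℕ} (hs : s ≤ p) (j : ℕ) (hj : j ≤ s) :
    (p - j).choose (s - j) * p ^ j ≤ s ^ j * p.choose s := by
  induction j with
  | zero => simp
  | succ j ih =>
    have ih := ih (by omega)
    have h1 : (p - j).choose (s - j) * (s - j) = (p - j) * (p - (j + 1)).choose (s - (j + 1)) := by
      have := Nat.add_one_mul_choose_eq (p - (j + 1)) (s - (j + 1))
      rw [show p - (j + 1) + 1 = p - j by omega, show s - (j + 1) + 1 = s - j by omega] at this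
      exact this.symm
    have h2 : (s - j) * p ≤ s * (p - j) := by
      zify [show j ≤ s by omega, show j ≤ p by omega]
      have : (j : ℤ) * s ≤ j * p := by gcongr
      linarith
    have hpos : 0 < p - j := by omega
    refine Nat.le_of_mul_le_mul_left ?_ hpos
    calc (p - j) * ((p - (j + 1)).choose (s - (j + 1)) * p ^ (j + 1))
        = ((p - j).choose (s - j) * p ^ j) * ((s - j) * p) := by rw [← mul_assoc, ← h1]; ring
      _ ≤ (s ^ j * p.choose s) * (s * (p - j)) := Nat.mul_le_mul ih h2
      _ = (p - j) * (s ^ (j + 1) * p.choose s) := by ring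

/-- The factorial moments of a hypergeometric variable are at most those of a Poisson variable of
the same mean. -/
theorem sum_descFactorial_inter_le {s : ℕ} (hs : s ≤ p) {S : Finset (Fin p)} (hS : S.card = s)
    (j : ℕ) :
    ∑ R ∈ (Finset.univ : Finset (Fin p)).powersetCard s, ((S ∩ R).card.descFactorial j : ℝ) ≤
      p.choose s * ((s : ℝ) ^ 2 / p) ^ j := by
  rcases Nat.lt_or_ge s j with hj | hj
  · rw [Finset.sum_eq_zero]
    · positivity
    · intro R _
      have : (S ∩ R).card ≤ s := hS ▸ Finset.card_le_card Finset.inter_subset_left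
      exact_mod_cast Nat.descFactorial_eq_zero_iff_lt.2 (by omega)
  -- Double counting of the pairs `(T, R)` with `T ⊆ S ∩ R` and `T` of size `j`.
  · have h1 : ∑ R ∈ (Finset.univ : Finset (Fin p)).powersetCard s, (S ∩ R).card.choose j =
        s.choose j * (p - j).choose (s - j) := by
      have : ∀ R : Finset (Fin p), (S ∩ R).card.choose j =
          ∑ T ∈ S.powersetCard j, if T ⊆ R then 1 else 0 := by
        intro R
        rw [← Finset.card_powersetCard, ← Finset.card_filter]
        congr 1
        ext T
        simp only [Finset.mem_powersetCard, Finset.mem_filter, Finset.subset_inter_iff]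
        tauto
      simp_rw [this]
      rw [Finset.sum_comm]
      simp_rw [← Finset.card_filter]
      rw [Finset.sum_congr rfl fun T hT => by
        rw [card_powersetCard_superset s T (by rw [(Finset.mem_powersetCard.1 hT).2]; exact hj),
          (Finset.mem_powersetCard.1 hT).2]]
      rw [Finset.sum_const, Finset.card_powersetCard, hS, smul_eq_mul]
    have h2 : ∑ R ∈ (Finset.univ : Finset (Fin p)).powersetCard s, (S ∩ R).card.descFactorial j =
        s.descFactorial j * (p - j).choose (s - j) := by
      simp_rw [Nat.descFactorial_eq_factorial_mul_choose]
      rw [← Finset.mul_sum, h1, mul_assoc]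
    rw [← Nat.cast_sum, h2]
    have h3 : s.descFactorial j * (p - j).choose (s - j) * p ^ j ≤ s ^ j * (s ^ j * p.choose s) := by
      rw [mul_assoc]
      exact Nat.mul_le_mul (Nat.descFactorial_le_pow _ _) (choose_sub_mul_pow_le hs j hj)
    rcases Nat.eq_zero_or_pos p with rfl | hp
    · have : s = 0 := by omega
      have : j = 0 := by omega
      subst j; subst s; simp
    · have hp' : (0 : ℝ) < (p : ℝ) ^ j := by positivity
      rw [div_pow, ← mul_div_assoc, le_div_iff₀ hp']
      have h4 : ((s.descFactorial j * (p - j).choose (s - j) * p ^ j : ℕ) : ℝ) ≤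
        ((s ^ j * (s ^ j * p.choose s) : ℕ) : ℝ) := by exact_mod_cast h3
      push_cast at h4 ⊢
      refine h4.trans (le_of_eq ?_)
      ring

/-- Carrying the falling factorial along makes the induction on `k` close: with `h` the overlap,
multiplying its `j`-th falling factorial by `h` gives the `(j+1)`-st plus `j` times the `j`-th.
Ordinary moments are the case `j = 0`. -/
theorem sum_pow_mul_descFactorial_inter_le {s : ℕ} (hs : s ≤ p) {S : Finset (Fin p)}
    (hS : S.card = s) (k j : ℕ) :
    ∑ R ∈ (Finset.univ : Finset (Fin p)).powersetCard s,
        ((S ∩ R).card : ℝ) ^ k * ((S ∩ R).card.descFactorial j : ℝ) ≤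
      p.choose s * (((s : ℝ) ^ 2 / p) ^ j * ((s : ℝ) ^ 2 / p + j + k) ^ k) := by
  set μ := (s : ℝ) ^ 2 / p with hμ
  have hμ0 : 0 ≤ μ := by positivity
  induction k generalizing j with
  | zero => simpa using sum_descFactorial_inter_le hs hS j
  | succ k ih =>
    have h1 : ∀ R : Finset (Fin p),
        ((S ∩ R).card : ℝ) ^ (k + 1) * ((S ∩ R).card.descFactorial j : ℝ) =
        ((S ∩ R).card : ℝ) ^ k * ((S ∩ R).card.descFactorial (j + 1) : ℝ) +
        j * (((S ∩ R).card : ℝ) ^ k * ((S ∩ R).card.descFactorial j : ℝ)) := by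
      intro R
      set h := (S ∩ R).card
      rcases Nat.lt_or_ge h j with hj | hj
      · simp [Nat.descFactorial_eq_zero_iff_lt.2 hj]
      · rw [Nat.descFactorial_succ]
        push_cast [hj]
        ring
    simp_rw [h1]
    rw [Finset.sum_add_distrib, ← Finset.mul_sum]
    have i1 := ih (j + 1)
    have i2 := ih j
    have hb : (μ + j + k) ^ k ≤ (μ + j + (k + 1)) ^ k := by gcongr; linarith
    push_cast at i1 ⊢
    calc _ ≤ (p.choose s : ℝ) * (μ ^ (j + 1) * (μ + (j + 1) + k) ^ k) +
          j * (p.choose s * (μ ^ j * (μ + j + k) ^ k)) := by gcongr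
      _ ≤ (p.choose s : ℝ) * (μ ^ (j + 1) * (μ + j + (k + 1)) ^ k) +
          j * (p.choose s * (μ ^ j * (μ + j + (k + 1)) ^ k)) := by
        rw [show μ + (j + 1 : ℝ) + k = μ + j + (k + 1) by ring]
        exact add_le_add le_rfl (mul_le_mul_of_nonneg_left (mul_le_mul_of_nonneg_left
          (mul_le_mul_of_nonneg_left hb (by positivity)) (by positivity)) (by positivity))
      _ = (p.choose s : ℝ) * (μ ^ j * ((μ + j + (k + 1)) ^ k * (μ + j))) := by ring
      _ ≤ (p.choose s : ℝ) * (μ ^ j * ((μ + j + (k + 1)) ^ k * (μ + j + (k + 1)))) := by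
        have h : μ + j ≤ μ + j + ((k : ℝ) + 1) := le_add_of_nonneg_right (by positivity)
        exact mul_le_mul_of_nonneg_left (mul_le_mul_of_nonneg_left
          (mul_le_mul_of_nonneg_left h (by positivity)) (by positivity)) (by positivity)
      _ = _ := by rw [← pow_succ]

/-- The moments of the size of the intersection with a uniform `s`-element set. -/
theorem sum_card_inter_pow_le {s : ℕ} (hs : s ≤ p) {S : Finset (Fin p)} (hS : S.card = s)
    (k : ℕ) :
    ∑ R ∈ (Finset.univ : Finset (Fin p)).powersetCard s, ((S ∩ R).card : ℝ) ^ k ≤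
      p.choose s * ((s : ℝ) ^ 2 / p + k) ^ k := by
  simpa using sum_pow_mul_descFactorial_inter_le hs hS k 0

end Hypergeometric

/-! ### The planted law as a finite Gaussian mixture. -/

section Planted

theorem pi_rademacher {ι : Type*} [Fintype ι] [DecidableEq ι] :
    Measure.pi (fun _ : ι => rademacher) =
      ∑ b : ι → Bool, (2⁻¹ : ENNReal) ^ Fintype.card ι • Measure.dirac fun i => boolSign (b i) := by
  have : IsFiniteMeasure rademacher := by
    rw [rademacher]
    exact ⟨by simp [ENNReal.inv_two_add_inv_two]⟩
  refine Measure.pi_eq fun A hA => ?_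
  have h1 : ∀ i, rademacher (A i) =
      ∑ b : Bool, 2⁻¹ * Measure.dirac (boolSign b) (A i) := by
    intro i
    simp [rademacher, boolSign]
  simp_rw [h1]
  rw [Finset.prod_univ_sum, Measure.finsetSum_apply, Fintype.piFinset_univ]
  refine Finset.sum_congr rfl fun b _ => ?_
  rw [Finset.prod_mul_distrib, Finset.prod_const, Finset.card_univ, Measure.smul_apply,
    smul_eq_mul, ← Measure.pi_pi]
  congr 1
  rw [Measure.pi_pi, Measure.dirac_apply' _ (MeasurableSet.univ_pi hA)]
  simp_rw [Measure.dirac_apply' _ (hA _)]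
  by_cases h : ∀ i, boolSign (b i) ∈ A i
  · rw [Set.indicator_of_mem (by simpa [Set.mem_pi] using h)]
    simp [h]
  · rw [Set.indicator_of_notMem (by simpa [Set.mem_pi] using h)]
    push Not at h
    obtain ⟨i, hi⟩ := h
    exact (Finset.prod_eq_zero (Finset.mem_univ i) (by simp [hi])).symm

/-- The possible supports of the centre. -/
abbrev SupportSet (p s : ℕ) : Type :=
  {S : Finset (Fin p) // S ∈ (Finset.univ : Finset (Fin p)).powersetCard s}

/-- The centre with given support and signs. -/
noncomputable def centreOf {p s : ℕ} (Δ : ℝ) (q : SupportSet p s × (Fin p → Bool)) : Fin p → ℝ :=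
  fun i => if i ∈ q.1.1 then Δ / √(s : ℝ) * boolSign (q.2 i) else 0

theorem centrePrior_eq (p s : ℕ) (Δ : ℝ) :
    centrePrior p s Δ = ∑ q : SupportSet p s × (Fin p → Bool),
      ((p.choose s : ENNReal)⁻¹ * 2⁻¹ ^ p) • Measure.dirac (centreOf Δ q) := by
  rw [centrePrior, ← Finset.sum_coe_sort, Fintype.sum_prod_type]
  refine Finset.sum_congr rfl fun S _ => ?_
  have hmeas : Measurable fun (r : Fin p → ℝ) i => if i ∈ S.1 then Δ / √(s : ℝ) * r i else 0 := by
    refine measurable_pi_lambda _ fun i => ?_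
    split_ifs <;> fun_prop
  rw [centrePriorGiven, pi_rademacher, Measure.map_finset_sum hmeas.aemeasurable, Finset.smul_sum]
  refine Finset.sum_congr rfl fun b _ => ?_
  rw [Measure.map_smul, Measure.map_dirac' hmeas, smul_smul, Fintype.card_fin]
  rfl

/-- The signal part `zᵢ θⱼ` of the data. -/
noncomputable def signalOf (n p s : ℕ) (Δ : ℝ)
    (k : (Fin n → Bool) × (SupportSet p s × (Fin p → Bool))) : Fin n × Fin p → ℝ :=
  fun ij => boolSign (k.1 ij.1) * centreOf Δ k.2 ij.2

/-- The planted law is an equally weighted mixture of shifts of the null law. -/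
theorem plantedLaw_eq_gaussianMixture (n p s : ℕ) (hsp : s ≤ p) (Δ : ℝ) :
    plantedLaw n p s Δ = gaussianMixture (2⁻¹ ^ n * ((p.choose s : ENNReal)⁻¹ * 2⁻¹ ^ p))
      (signalOf n p s Δ) := by
  have hc : (p.choose s : ENNReal) ≠ 0 := by
    exact_mod_cast (Nat.choose_pos hsp).ne'
  have hw1 : (2⁻¹ : ENNReal) ^ n ≠ ⊤ := by simp
  have hw2 : (p.choose s : ENNReal)⁻¹ * 2⁻¹ ^ p ≠ ⊤ := ENNReal.mul_ne_top (by simpa using hc) (by simp)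
  set w1 : ENNReal := 2⁻¹ ^ n with hw1'
  set w2 : ENNReal := (p.choose s : ENNReal)⁻¹ * 2⁻¹ ^ p with hw2'
  have hfin1 : ∀ z : Fin n → ℝ, IsFiniteMeasure (w1 • Measure.dirac z) := fun z =>
    Measure.smul_finite _ hw1
  have hfin2 : ∀ z : Fin p → ℝ, IsFiniteMeasure (w2 • Measure.dirac z) := fun z =>
    Measure.smul_finite _ hw2
  have hprior : (labelPrior n).prod (centrePrior p s Δ) =
      Measure.sum fun k : (Fin n → Bool) × (SupportSet p s × (Fin p → Bool)) =>
        (w1 * w2) • Measure.dirac ((fun i => boolSign (k.1 i)), centreOf Δ k.2) := by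
    rw [labelPrior, pi_rademacher, centrePrior_eq, ← Measure.sum_fintype, ← Measure.sum_fintype,
      Fintype.card_fin, Measure.prod_sum]
    congr 1
    ext1 k
    rw [Measure.prod_smul_left, ← hw2', Measure.prod_smul_right, Measure.dirac_prod_dirac,
      smul_smul]
  have hQ : IsProbabilityMeasure (nullLaw n p) := by rw [nullLaw]; infer_instance
  rw [plantedLaw, hprior, Measure.prod_sum_left, Measure.sum_fintype, gaussianMixture]
  rw [Measure.map_finset_sum (by fun_prop)]
  refine Finset.sum_congr rfl fun k _ => ?_
  rw [Measure.prod_smul_left, Measure.map_smul, Measure.dirac_prod, Measure.map_map (by fun_prop)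
    (by fun_prop), nullLaw]
  congr 2
  ext x ij
  simp [signalOf, add_comm]

/-- The signals have rank one, so labels and centres separate, and only coordinates in both supports
survive. -/
theorem sum_signalOf_mul {n p s : ℕ} (Δ : ℝ)
    (k l : (Fin n → Bool) × (SupportSet p s × (Fin p → Bool))) :
    ∑ ij, signalOf n p s Δ k ij * signalOf n p s Δ l ij =
      Δ ^ 2 / s * ((∑ i, boolSign (k.1 i) * boolSign (l.1 i)) *
        ∑ j ∈ k.2.1.1 ∩ l.2.1.1, boolSign (k.2.2 j) * boolSign (l.2.2 j)) := by
  have hΔ : (Δ / √(s : ℝ)) ^ 2 = Δ ^ 2 / s := by rw [div_pow, Real.sq_sqrt (Nat.cast_nonneg s)]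
  rw [Fintype.sum_prod_type, ← hΔ, Finset.sum_mul, Finset.mul_sum]
  refine Finset.sum_congr rfl fun i _ => ?_
  have e : ∑ j ∈ k.2.1.1 ∩ l.2.1.1, boolSign (k.2.2 j) * boolSign (l.2.2 j) =
      ∑ j, if j ∈ k.2.1.1 ∩ l.2.1.1 then boolSign (k.2.2 j) * boolSign (l.2.2 j) else 0 := by
    rw [Finset.sum_ite_mem, Finset.univ_inter]
  rw [e, Finset.mul_sum, Finset.mul_sum]
  refine Finset.sum_congr rfl fun j _ => ?_
  simp only [signalOf, centreOf, Finset.mem_inter]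
  by_cases h1 : j ∈ k.2.1.1 <;> by_cases h2 : j ∈ l.2.1.1 <;> simp [h1, h2]
  ring

/-- The coordinatewise product of two independent uniform sign vectors is itself uniform, so one of
the two averages is trivial. -/
theorem sq_mul_sum_sum_signs {ι : Type*} [Fintype ι] [DecidableEq ι] (T : Finset ι) (d : ℕ) :
    ((2⁻¹ : ℝ) ^ Fintype.card ι) ^ 2 *
      ∑ a : ι → Bool, ∑ b : ι → Bool, (∑ i ∈ T, boolSign (a i) * boolSign (b i)) ^ d =
      signMoment T d := by
  rw [sq, mul_assoc, Finset.mul_sum]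
  simp_rw [signMoment_eq_mul]
  rw [Finset.sum_const, Finset.card_univ, Fintype.card_fun, Fintype.card_bool, nsmul_eq_mul,
    ← mul_assoc]
  push_cast
  rw [← mul_pow]
  norm_num

/-- The normalised sum of the `d`-th powers of the inner products of two independent signals. -/
theorem sum_pow_signalOf (n p s : ℕ) (Δ : ℝ) (d : ℕ) :
    (2⁻¹ ^ n * ((p.choose s : ENNReal)⁻¹ * 2⁻¹ ^ p)).toReal ^ 2 *
      ∑ k, ∑ l, (∑ ij, signalOf n p s Δ k ij * signalOf n p s Δ l ij) ^ d =
    (Δ ^ 2 / s) ^ d * signMoment (Finset.univ : Finset (Fin n)) d *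
      ((p.choose s : ℝ)⁻¹ ^ 2 * ∑ S ∈ (Finset.univ : Finset (Fin p)).powersetCard s,
        ∑ R ∈ (Finset.univ : Finset (Fin p)).powersetCard s, signMoment (S ∩ R) d) := by
  have hw : (2⁻¹ ^ n * ((p.choose s : ENNReal)⁻¹ * 2⁻¹ ^ p)).toReal =
      2⁻¹ ^ n * ((p.choose s : ℝ)⁻¹ * 2⁻¹ ^ p) := by simp
  have hlabel := sq_mul_sum_sum_signs (Finset.univ : Finset (Fin n)) d
  have hsupp : ∀ f : Finset (Fin p) → ℝ,
      ∑ S : SupportSet p s, f S.1 =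
        ∑ S ∈ (Finset.univ : Finset (Fin p)).powersetCard s, f S := fun f =>
    Finset.sum_coe_sort _ f
  have hcentre : (2⁻¹ ^ p) ^ 2 * ∑ q : SupportSet p s × (Fin p → Bool),
      ∑ r : SupportSet p s × (Fin p → Bool),
        (∑ j ∈ q.1.1 ∩ r.1.1, boolSign (q.2 j) * boolSign (r.2 j)) ^ d =
      ∑ S ∈ (Finset.univ : Finset (Fin p)).powersetCard s,
        ∑ R ∈ (Finset.univ : Finset (Fin p)).powersetCard s, signMoment (S ∩ R) d := by
    rw [← hsupp, Fintype.sum_prod_type, Finset.mul_sum]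
    refine Finset.sum_congr rfl fun S _ => ?_
    simp_rw [Fintype.sum_prod_type]
    rw [← hsupp, Finset.sum_comm, Finset.mul_sum]
    refine Finset.sum_congr rfl fun R _ => ?_
    rw [← sq_mul_sum_sum_signs, Fintype.card_fin]
  have hsplit : ∀ (X : (Fin n → Bool) → (Fin n → Bool) → ℝ)
      (Y : SupportSet p s × (Fin p → Bool) → SupportSet p s × (Fin p → Bool) → ℝ),
      ∑ k : (Fin n → Bool) × (SupportSet p s × (Fin p → Bool)),
        ∑ l : (Fin n → Bool) × (SupportSet p s × (Fin p → Bool)), X k.1 l.1 * Y k.2 l.2 =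
      (∑ a, ∑ b, X a b) * ∑ q, ∑ r, Y q r := by
    intro X Y
    rw [Fintype.sum_prod_type, Finset.sum_mul]
    refine Finset.sum_congr rfl fun a _ => ?_
    rw [Finset.mul_sum]
    refine Finset.sum_congr rfl fun q _ => ?_
    rw [Fintype.sum_prod_type, Finset.sum_mul_sum]
  simp_rw [sum_signalOf_mul, mul_pow, ← Finset.mul_sum]
  rw [hsplit (fun a b => (∑ i, boolSign (a i) * boolSign (b i)) ^ d)
    (fun q r => (∑ j ∈ q.1.1 ∩ r.1.1, boolSign (q.2 j) * boolSign (r.2 j)) ^ d), ← hlabel,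
    ← hcentre, hw, Fintype.card_fin]
  ring

/-- The squared low-degree norm of the planted law. -/
theorem isGreatest_plantedLaw (n p s : ℕ) (hsp : s ≤ p) (Δ : ℝ) (D : ℕ) :
    IsGreatest (lowDegreeRatios (plantedLaw n p s Δ) (nullLaw n p) D)
      (√(∑ d ∈ Finset.range (D + 1), (Δ ^ 2 / s) ^ d *
        signMoment (Finset.univ : Finset (Fin n)) d *
        ((p.choose s : ℝ)⁻¹ ^ 2 * ∑ S ∈ (Finset.univ : Finset (Fin p)).powersetCard s,
          ∑ R ∈ (Finset.univ : Finset (Fin p)).powersetCard s, signMoment (S ∩ R) d) /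
        d.factorial)) := by
  have hc : (p.choose s : ENNReal) ≠ 0 := by exact_mod_cast (Nat.choose_pos hsp).ne'
  have hw : 2⁻¹ ^ n * ((p.choose s : ENNReal)⁻¹ * 2⁻¹ ^ p) ≠ ⊤ :=
    ENNReal.mul_ne_top (by simp) (ENNReal.mul_ne_top (by simpa using hc) (by simp))
  have hP : IsProbabilityMeasure (plantedLaw n p s Δ) := by
    rw [plantedLaw_eq_gaussianMixture n p s hsp]
    refine ⟨?_⟩
    have hmass : ∀ u : Fin n × Fin p → ℝ,
        ((Measure.pi fun _ : Fin n × Fin p => gaussianReal 0 1).map fun x => x + u) Set.univ =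
          1 := by
      intro u
      rw [Measure.map_apply (by fun_prop) MeasurableSet.univ]
      simp
    simp only [gaussianMixture, Measure.finsetSum_apply, Measure.smul_apply, hmass]
    have h2 : ∀ m : ℕ, (2 : ENNReal) ^ m * 2⁻¹ ^ m = 1 := fun m => by
      rw [← mul_pow, ENNReal.mul_inv_cancel (by simp) (by simp), one_pow]
    have hC : (p.choose s : ENNReal) * (p.choose s : ENNReal)⁻¹ = 1 :=
      ENNReal.mul_inv_cancel hc (by simp)
    simp only [smul_eq_mul, mul_one, Finset.sum_const, Finset.card_univ, nsmul_eq_mul,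
      Fintype.card_prod, Fintype.card_fun, Fintype.card_bool, Fintype.card_fin,
      Fintype.card_coe, Finset.card_powersetCard]
    push_cast
    calc _ = ((2 : ENNReal) ^ n * 2⁻¹ ^ n) * (((p.choose s : ENNReal) * (p.choose s : ENNReal)⁻¹) *
          ((2 : ENNReal) ^ p * 2⁻¹ ^ p)) := by ring
      _ = 1 := by rw [h2, h2, hC]; simp
  have key := isGreatest_lowDegreeRatios (plantedLaw n p s Δ) (fun f => by
    rw [plantedLaw_eq_gaussianMixture n p s hsp]
    exact integrable_eval_gaussianMixture hw _ f) D
  rw [plantedLaw_eq_gaussianMixture n p s hsp,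
    sum_sq_integral_mvHermite_gaussianMixture hw] at key
  simp_rw [sum_pow_signalOf] at key
  rw [plantedLaw_eq_gaussianMixture n p s hsp]
  exact key

end Planted

/-! ### Bounding each degree and summing the geometric series. -/

section Bound

/-- The degree-`d` part of the squared low-degree norm of the planted law. -/
noncomputable def degreeTerm (n p s : ℕ) (Δ : ℝ) (d : ℕ) : ℝ :=
  (Δ ^ 2 / s) ^ d * signMoment (Finset.univ : Finset (Fin n)) d *
    ((p.choose s : ℝ)⁻¹ ^ 2 * ∑ S ∈ (Finset.univ : Finset (Fin p)).powersetCard s,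
      ∑ R ∈ (Finset.univ : Finset (Fin p)).powersetCard s, signMoment (S ∩ R) d) / d.factorial

theorem degreeTerm_of_odd (n p s : ℕ) (Δ : ℝ) {d : ℕ} (hd : Odd d) :
    degreeTerm n p s Δ d = 0 := by
  simp [degreeTerm, signMoment_of_odd _ hd]

theorem degreeTerm_nonneg (n p s : ℕ) (Δ : ℝ) (d : ℕ) : 0 ≤ degreeTerm n p s Δ d := by
  rcases Nat.even_or_odd d with hd | hd
  · have h1 := signMoment_nonneg_of_even (Finset.univ : Finset (Fin n)) hd
    have h2 : 0 ≤ ∑ S ∈ (Finset.univ : Finset (Fin p)).powersetCard s,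
        ∑ R ∈ (Finset.univ : Finset (Fin p)).powersetCard s, signMoment (S ∩ R) d :=
      Finset.sum_nonneg fun S _ => Finset.sum_nonneg fun R _ =>
        signMoment_nonneg_of_even (S ∩ R) hd
    have h3 : 0 ≤ Δ ^ 2 / s := by positivity
    unfold degreeTerm
    positivity
  · rw [degreeTerm_of_odd n p s Δ hd]

theorem degreeTerm_zero (n p s : ℕ) (hsp : s ≤ p) (Δ : ℝ) : degreeTerm n p s Δ 0 = 1 := by
  have hc : (p.choose s : ℝ) ≠ 0 := by exact_mod_cast (Nat.choose_pos hsp).ne'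
  simp only [degreeTerm, signMoment_zero_right, Finset.sum_const, Finset.card_powersetCard,
    Finset.card_univ, Fintype.card_fin, nsmul_eq_mul, pow_zero, Nat.factorial_zero, Nat.cast_one]
  field_simp

/-- This is the bound `4^k` on the central binomial coefficient. It lets the `1/d!` of the Hermite
expansion absorb both double factorials from the sign moments. -/
theorem factorial_two_mul_le (k : ℕ) : (2 * k).factorial ≤ (2 ^ k * k.factorial) ^ 2 := by
  have h := Nat.add_choose_mul_factorial_mul_factorial k k
  have h2 : (k + k).choose k ≤ 2 ^ (k + k) := Nat.choose_le_two_pow _ _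
  rw [two_mul, ← h]
  calc (k + k).choose k * k.factorial * k.factorial ≤ 2 ^ (k + k) * k.factorial * k.factorial := by
        gcongr
    _ = (2 ^ k * k.factorial) ^ 2 := by ring

theorem degreeTerm_two_mul_le {n p s : ℕ} (hs : 1 ≤ s) (hsp : s ≤ p) (Δ : ℝ) (k : ℕ) :
    degreeTerm n p s Δ (2 * k) ≤
      ((n : ℝ) * Δ ^ 4 / p + (n : ℝ) * Δ ^ 4 * k / (s : ℝ) ^ 2) ^ k := by
  set G : ℝ := (2 * k).factorial / (2 ^ k * k.factorial) with hG
  have hC : (0 : ℝ) < p.choose s := by exact_mod_cast Nat.choose_pos hsp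
  have hs0 : (0 : ℝ) < s := by exact_mod_cast hs
  have hp0 : (0 : ℝ) < p := by exact_mod_cast hs.trans hsp
  have h1 : signMoment (Finset.univ : Finset (Fin n)) (2 * k) ≤ G * (n : ℝ) ^ k := by
    simpa using signMoment_le (Finset.univ : Finset (Fin n)) k
  have h2 : ∑ S ∈ (Finset.univ : Finset (Fin p)).powersetCard s,
      ∑ R ∈ (Finset.univ : Finset (Fin p)).powersetCard s, signMoment (S ∩ R) (2 * k) ≤
      (p.choose s : ℝ) ^ 2 * (G * ((s : ℝ) ^ 2 / p + k) ^ k) := by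
    calc _ ≤ ∑ S ∈ (Finset.univ : Finset (Fin p)).powersetCard s,
          G * (p.choose s * ((s : ℝ) ^ 2 / p + k) ^ k) := by
          refine Finset.sum_le_sum fun S hS => ?_
          refine (Finset.sum_le_sum fun R _ => signMoment_le (S ∩ R) k).trans ?_
          rw [← Finset.mul_sum]
          exact mul_le_mul_of_nonneg_left
            (sum_card_inter_pow_le hsp (Finset.mem_powersetCard.1 hS).2 k) (by positivity)
      _ = _ := by
          rw [Finset.sum_const, Finset.card_powersetCard, Finset.card_univ, Fintype.card_fin,
            nsmul_eq_mul]
          ring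
  -- `G` is `(2k-1)!!`, and it enters once from the labels and once from the centre.
  have h3 : G ^ 2 / (2 * k).factorial ≤ 1 := by
    have : ((2 * k).factorial : ℝ) ≤ (2 ^ k * k.factorial) ^ 2 := by
      exact_mod_cast factorial_two_mul_le k
    have hpos : (0 : ℝ) < (2 * k).factorial := by positivity
    rw [hG, div_pow, div_div, div_le_one (by positivity), sq, mul_comm _ ((2 * k).factorial : ℝ)]
    gcongr
  have h0 := signMoment_nonneg_of_even (Finset.univ : Finset (Fin n)) (even_two_mul k)
  calc degreeTerm n p s Δ (2 * k)
      ≤ (Δ ^ 2 / s) ^ (2 * k) * (G * (n : ℝ) ^ k) * ((p.choose s : ℝ)⁻¹ ^ 2 *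
        ((p.choose s : ℝ) ^ 2 * (G * ((s : ℝ) ^ 2 / p + k) ^ k))) / (2 * k).factorial := by
        unfold degreeTerm
        refine div_le_div_of_nonneg_right ?_ (by positivity)
        refine mul_le_mul (mul_le_mul_of_nonneg_left h1 (by positivity))
          (mul_le_mul_of_nonneg_left h2 (by positivity)) ?_ (by positivity)
        exact mul_nonneg (by positivity) (Finset.sum_nonneg fun S _ => Finset.sum_nonneg
          fun R _ => signMoment_nonneg_of_even (S ∩ R) (even_two_mul k))
    _ = (G ^ 2 / (2 * k).factorial) *
        ((Δ ^ 2 / s) ^ 2 * n * ((s : ℝ) ^ 2 / p + k)) ^ k := by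
        rw [mul_pow, mul_pow, ← pow_mul]
        field_simp
    _ ≤ 1 * ((Δ ^ 2 / s) ^ 2 * n * ((s : ℝ) ^ 2 / p + k)) ^ k := by gcongr
    _ = _ := by
        rw [one_mul]
        congr 1
        field_simp

theorem one_le_sum_degreeTerm (n p s : ℕ) (hsp : s ≤ p) (Δ : ℝ) (D : ℕ) :
    1 ≤ ∑ d ∈ Finset.range (D + 1), degreeTerm n p s Δ d := by
  rw [← degreeTerm_zero n p s hsp Δ]
  exact Finset.single_le_sum (fun d _ => degreeTerm_nonneg n p s Δ d) (by simp)

theorem sum_degreeTerm_sub_one_le {n p s D : ℕ} (hs : 1 ≤ s) (hsp : s ≤ p) {Δ x c : ℝ}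
    (hx : x = (n : ℝ) * Δ ^ 4 / p + (n : ℝ) * Δ ^ 4 * D / (s : ℝ) ^ 2) (hxc : x ≤ c)
    (hc : c < 1) :
    ∑ d ∈ Finset.range (D + 1), degreeTerm n p s Δ d - 1 ≤ (1 - c)⁻¹ * x := by
  have hx0 : 0 ≤ x := by rw [hx]; positivity
  have hx1 : 0 < 1 - x := by linarith
  have h1 : ∑ d ∈ Finset.range (D + 1), degreeTerm n p s Δ d ≤
      ∑ k ∈ Finset.range (D + 1), x ^ k := by
    -- Running up to degree `2 * D` only adds nonnegative terms, and makes the even degrees exactly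
    -- `2 * k` with `k ≤ D`, whatever the parity of `D`.
    calc _ ≤ ∑ d ∈ Finset.range (2 * D + 1), degreeTerm n p s Δ d :=
          Finset.sum_le_sum_of_subset_of_nonneg (Finset.range_mono (by omega))
            fun d _ _ => degreeTerm_nonneg n p s Δ d
      _ = ∑ k ∈ Finset.range (D + 1), degreeTerm n p s Δ (2 * k) :=
          sum_range_two_mul_add_one _ (fun j => degreeTerm_of_odd n p s Δ ⟨j, rfl⟩) D
      _ ≤ _ := by
          refine Finset.sum_le_sum fun k hk => (degreeTerm_two_mul_le hs hsp Δ k).trans ?_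
          have hkD : k ≤ D := Nat.lt_succ_iff.1 (Finset.mem_range.1 hk)
          rw [hx]
          gcongr
  have h2 : ∑ k ∈ Finset.range (D + 1), x ^ k ≤ (1 - x)⁻¹ := by
    rw [← tsum_geometric_of_lt_one hx0 (by linarith)]
    exact (summable_geometric_of_lt_one hx0 (by linarith)).sum_le_tsum _ fun _ _ => by positivity
  have h3 : (1 - x)⁻¹ - 1 = (1 - x)⁻¹ * x := by field_simp; ring
  have h4 : (1 - x)⁻¹ * x ≤ (1 - c)⁻¹ * x := by
    gcongr
  linarith

theorem sq_lowDegreeNorm_plantedLaw (n p s : ℕ) (hsp : s ≤ p) (Δ : ℝ) (D : ℕ) :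
    lowDegreeNorm (plantedLaw n p s Δ) (nullLaw n p) D ^ 2 =
      ∑ d ∈ Finset.range (D + 1), degreeTerm n p s Δ d := by
  rw [lowDegreeNorm, (isGreatest_plantedLaw n p s hsp Δ D).csSup_eq]
  exact Real.sq_sqrt (zero_le_one.trans (one_le_sum_degreeTerm n p s hsp Δ D))

end Bound

end SparseClustering

/-! ### The asymptotic statement. -/

theorem theorem3 (p s D : ℕ → ℕ) (Δ : ℕ → ℝ)
    (hs : ∀ n, 1 ≤ s n) (hsp : ∀ n, s n ≤ p n)
    (hlim : limsup (fun n : ℕ =>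
      ((√((n : ℝ) * Δ n ^ 4 / (p n : ℝ)) +
        √(4 * (n : ℝ) * Δ n ^ 4 * (D n : ℝ) / (s n : ℝ) ^ 2) : ℝ) : EReal)) atTop < 1) :
    (∀ n, IsGreatest
      (SparseClustering.lowDegreeRatios (SparseClustering.plantedLaw n (p n) (s n) (Δ n))
        (SparseClustering.nullLaw n (p n)) (D n))
      (SparseClustering.lowDegreeNorm (SparseClustering.plantedLaw n (p n) (s n) (Δ n))
        (SparseClustering.nullLaw n (p n)) (D n))) ∧
    (fun n : ℕ =>
      SparseClustering.lowDegreeNorm (SparseClustering.plantedLaw n (p n) (s n) (Δ n))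
        (SparseClustering.nullLaw n (p n)) (D n) ^ 2 - 1) =O[atTop]
      (fun n : ℕ => (n : ℝ) * Δ n ^ 4 / (p n : ℝ) +
        (n : ℝ) * Δ n ^ 4 * (D n : ℝ) / (s n : ℝ) ^ 2) := by
  refine ⟨fun n => ?_, ?_⟩
  · have h := SparseClustering.isGreatest_plantedLaw n (p n) (s n) (hsp n) (Δ n) (D n)
    rw [SparseClustering.lowDegreeNorm, h.csSup_eq]
    exact h
  · obtain ⟨c, hlc, hc1⟩ := EReal.lt_iff_exists_real_btwn.1 hlim
    have hc : c < 1 := by exact_mod_cast hc1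
    -- The limsup controls a sum of square roots, so the geometric ratio `a + b` is at most the
    -- square of `c`.
    refine IsBigO.of_bound (1 - c ^ 2)⁻¹ ?_
    filter_upwards [eventually_lt_of_limsup_lt hlc] with n hn
    have hn : √((n : ℝ) * Δ n ^ 4 / (p n : ℝ)) +
        √(4 * (n : ℝ) * Δ n ^ 4 * (D n : ℝ) / (s n : ℝ) ^ 2) < c := by exact_mod_cast hn
    set a := (n : ℝ) * Δ n ^ 4 / (p n : ℝ) with ha
    set b := (n : ℝ) * Δ n ^ 4 * (D n : ℝ) / (s n : ℝ) ^ 2 with hb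
    have e : 4 * (n : ℝ) * Δ n ^ 4 * (D n : ℝ) / (s n : ℝ) ^ 2 = 4 * b := by rw [hb]; ring
    rw [e] at hn
    have ha0 : 0 ≤ a := by positivity
    have hb0 : 0 ≤ b := by positivity
    have hsa := Real.sqrt_nonneg a
    have hsb := Real.sqrt_nonneg (4 * b)
    have hab : a + b ≤ c ^ 2 := by
      have h1 := Real.sq_sqrt ha0
      have h2 := Real.sq_sqrt (show 0 ≤ 4 * b by positivity)
      have h3 : (√a + √(4 * b)) ^ 2 ≤ c ^ 2 := by gcongr
      nlinarith [mul_nonneg hsa hsb]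
    have hc2 : c ^ 2 < 1 := by
      -- `c` strictly exceeds a sum of square roots, so squaring preserves `c < 1`.
      have : 0 < c := by linarith
      nlinarith
    have hupper := SparseClustering.sum_degreeTerm_sub_one_le (D := D n) (hs n) (hsp n)
      (x := a + b) rfl hab hc2
    have hlower := SparseClustering.one_le_sum_degreeTerm n (p n) (s n) (hsp n) (Δ n) (D n)
    rw [SparseClustering.sq_lowDegreeNorm_plantedLaw n (p n) (s n) (hsp n),
      Real.norm_of_nonneg (by linarith), Real.norm_of_nonneg (by positivity)]
    exact hupper
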